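/- Let $\mathcal H_A,\mathcal H_{A'},\mathcal H_B$ be finite-dimensional complex Hilbert spaces with fixed orthonormal bases, and let $\Phi_1\neq\Phi_2:\mathcal L(\mathcal H_A)\to\mathcal L(\mathcal H_B)$ be two distinct quantum channels (completely positive trace-preserving maps), $\Delta=\Phi_1-\Phi_2$. Let $$J(\Delta)=\sum_{k,l}\Delta(|k\rangle\langle l|)\otimes|k\rangle\langle l|\in\mathcal L(\mathcal H_B\otimes\mathcal H_A)$$ be the Choi operator and $M(\Delta)=\operatorname{Tr}_B|J(\Delta)|$, where $|J|=\sqrt{J^\dagger J}$. A density operator $\rho$ on $\mathcal H_A\otimes\mathcal H_{A'}$ is called an optimal input for discriminating $\Phi_1,\Phi_2$ if, together with a suitable two-outcome measurement on the output, it attains the maximum of the success probability $$\tfrac12\operatorname{Tr}\big[E_1(\Phi_1\otimes I_{A'})(\rho)\big]+\tfrac12\operatorname{Tr}\big[E_2(\Phi_2\otimes I_{A'})(\rho)\big],\qquad E_1,E_2\ge 0,\ E_1+E_2=I,$$ over all density operators $\rho$ on $\mathcal H_A\otimes\mathcal H_{A'}$ and all measurements $\{E_1,E_2\}$ on $\mathcal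 H_B\otimes\mathcal H_{A'}$. Then: 1. If $\rho_{AA'}$ is an optimal input, then $$\big(\operatorname{Tr}_{A'}\rho_{AA'}\big)^{T}\in\mathcal D\big(\operatorname{supp}M(\Delta)\big),$$ i.e. the transpose, in the fixed basis of $\mathcal H_A$, of the reduced state is a density operator whose support is contained in $\operatorname{supp}M(\Delta)$. 2. Consequently, a state $\rho_{AA'}$ with $\operatorname{rank}(\operatorname{Tr}_{A'}\rho_{AA'})>\operatorname{rank}M(\Delta)$ is not optimal; in particular, a pure input $|\psi\rangle\langle\psi|$ whose Schmidt rank exceeds $\operatorname{rank}M(\Delta)$ is not optimal. -/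

import Mathlib

open scoped ComplexOrder MatrixOrder Kronecker

namespace ChannelDiscrimination

/-! Finite-dimensional systems are modelled as `ℂ^a` for a finite index type `a`, with operators
`Matrix a a ℂ`; the system `A ⊗ A'` has the index type `a × a'`. -/

variable {a a' b : Type*} [Fintype a] [DecidableEq a] [Fintype a'] [DecidableEq a']
  [Fintype b] [DecidableEq b]

open scoped Matrix.Norms.L2Operator in
/-- A quantum channel `L(ℂ^a) → L(ℂ^b)`: a completely positive, trace preserving linear map. -/
structure QuantumChannel (a b : Type*) [Fintype a] [DecidableEq a] [Fintype b] [DecidableEq b]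
    extends CompletelyPositiveMap (Matrix a a ℂ) (Matrix b b ℂ) where
  trace_preserving : ∀ X : Matrix a a ℂ, (toFun X).trace = X.trace

open scoped Matrix.Norms.L2Operator in
/-- The channel as a linear map (superoperator). -/
def QuantumChannel.map (Φ : QuantumChannel a b) : Matrix a a ℂ →ₗ[ℂ] Matrix b b ℂ :=
  Φ.toLinearMap

/-- A density operator. -/
def IsDensity (ρ : Matrix a a ℂ) : Prop :=
  ρ.PosSemidef ∧ ρ.trace = 1

/-- The support of a Hermitian operator, i.e. its range. -/
def supp (N : Matrix a a ℂ) : Submodule ℂ (a → ℂ) :=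
  LinearMap.range N.mulVecLin

/-- `σ ∈ 𝒟(V)`: `σ` is a density operator on the subspace `V` of `ℂ^a`. -/
def IsDensityOn (V : Submodule ℂ (a → ℂ)) (σ : Matrix a a ℂ) : Prop :=
  IsDensity σ ∧ supp σ ≤ V

/-- Partial trace over the first tensor factor. -/
def traceFirst (N : Matrix (b × a) (b × a) ℂ) : Matrix a a ℂ :=
  Matrix.of fun k l => ∑ i, N (i, k) (i, l)

/-- Partial trace over the second tensor factor. -/
def traceSecond (N : Matrix (a × a') (a × a') ℂ) : Matrix a a ℂ :=
  Matrix.of fun i j => ∑ k, N (i, k) (j, k)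

/-- `S ⊗ I_{A'}` : the superoperator `S` applied to the first factor of `A ⊗ A'`. -/
def ampliate (S : Matrix a a ℂ →ₗ[ℂ] Matrix b b ℂ) (X : Matrix (a × a') (a × a') ℂ) :
    Matrix (b × a') (b × a') ℂ :=
  Matrix.of fun p q => S (Matrix.of fun i j => X (i, p.2) (j, q.2)) p.1 q.1

/-- The Choi operator `J(S) = ∑ₖₗ S(|k⟩⟨l|) ⊗ |k⟩⟨l|`. -/
def choi (S : Matrix a a ℂ →ₗ[ℂ] Matrix b b ℂ) : Matrix (b × a) (b × a) ℂ :=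
  ∑ k, ∑ l, S (Matrix.single k l 1) ⊗ₖ Matrix.single k l (1 : ℂ)

/-- The M-operator `M(S) = Tr_B |J(S)|`, with `|J| = √(J† J)`. -/
noncomputable def mOperator (S : Matrix a a ℂ →ₗ[ℂ] Matrix b b ℂ) : Matrix a a ℂ :=
  traceFirst (CFC.abs (choi S))

/-- A two-outcome measurement (POVM) `{E₁, E₂}`. -/
def IsMeasurement (E₁ E₂ : Matrix a a ℂ) : Prop :=
  E₁.PosSemidef ∧ E₂.PosSemidef ∧ E₁ + E₂ = 1

/-- The probability of identifying correctly which of the two equally likely channels `Φ₁`, `Φ₂`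
acts, when it is applied to the `A` part of `ρ` and `{E₁, E₂}` is measured on the output
(outcome `i` meaning the guess `Φᵢ`). -/
noncomputable def successProb (Φ₁ Φ₂ : QuantumChannel a b) (ρ : Matrix (a × a') (a × a') ℂ)
    (E₁ E₂ : Matrix (b × a') (b × a') ℂ) : ℝ :=
  (1 / 2) * (E₁ * ampliate Φ₁.map ρ).trace.re + (1 / 2) * (E₂ * ampliate Φ₂.map ρ).trace.re

/-- `ρ` is an optimal input for discriminating `Φ₁` and `Φ₂`: with some measurement it attains
the maximal success probability over all input states on `A ⊗ A'` and all measurements. -/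
def IsOptimalInput (Φ₁ Φ₂ : QuantumChannel a b) (ρ : Matrix (a × a') (a × a') ℂ) : Prop :=
  IsDensity ρ ∧ ∃ E₁ E₂ : Matrix (b × a') (b × a') ℂ, IsMeasurement E₁ E₂ ∧
    ∀ (τ : Matrix (a × a') (a × a') ℂ) (F₁ F₂ : Matrix (b × a') (b × a') ℂ),
      IsDensity τ → IsMeasurement F₁ F₂ → successProb Φ₁ Φ₂ τ F₁ F₂ ≤ successProb Φ₁ Φ₂ ρ E₁ E₂

/-- `ψ` has Schmidt rank `r`: it has a Schmidt decomposition `ψ = ∑ₛ λₛ eₛ ⊗ fₛ` with orthonormal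
families `e`, `f` and exactly `r` coefficients, all of them positive. -/
def HasSchmidtRank (ψ : EuclideanSpace ℂ (a × a')) (r : ℕ) : Prop :=
  ∃ (c : Fin r → ℝ) (e : Fin r → EuclideanSpace ℂ a) (f : Fin r → EuclideanSpace ℂ a'),
    (∀ s, 0 < c s) ∧ Orthonormal ℂ e ∧ Orthonormal ℂ f ∧
      ∀ i k, ψ (i, k) = ∑ s, (c s : ℂ) * (e s i * f s k)

/-- The pure state `|ψ⟩⟨ψ|`. -/
def pureState (ψ : EuclideanSpace ℂ a) : Matrix a a ℂ :=
  Matrix.of fun i j => ψ i * star (ψ j)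

end ChannelDiscrimination

/-!
Let `Δ = Φ₁ - Φ₂`. Writing `E₂ = 1 - E₁` and using that channels preserve the trace, the success
probability is `1/2 + 1/2 Tr (E₁ (Δ ⊗ I)(ρ))`. Its maximum exceeds `1/2` because `Δ ≠ 0`: some
density operator `σ` has `Δ σ ≠ 0`, and `Δ σ` is Hermitian and traceless, so a measurement detects
it. As the advantage over `1/2` is linear in `ρ`, an optimal `ρ` with advantage `m > 0` satisfies
`Tr (E₁ (Δ ⊗ I)(X)) ≤ m Tr X` for every positive semidefinite `X`
(`IsOptimalInput.exists_advantage`).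

If `M(Δ) v = 0`, then `|J(Δ)|`, hence `J(Δ)`, kills every `eᵢ ⊗ v`, which means that `Δ` vanishes on
all operators `|u⟩⟨v̄|` (`map_vecMulVec_eq_zero_of_mOperator_mulVec_eq_zero`). So `Δ ⊗ I` does not
change when its argument is compressed by `P ⊗ 1`, where `P` is the projection onto the complement of
`v̄` (`map_complProj_mul_mul`). The compressed `ρ` has advantage `m` as well, so its trace, which is
`1 - ⟨v, (Tr_{A'} ρ)ᵀ v⟩ / ⟨v, v⟩`, is at least `1`, and `(Tr_{A'} ρ)ᵀ v = 0`. The kernel of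
`M(Δ)` is thus contained in that of `(Tr_{A'} ρ)ᵀ`, and taking orthogonal complements gives the
inclusion of supports.

The rank statements follow by comparing dimensions, since the left Schmidt vectors of `ψ` are
eigenvectors of the reduced state with nonzero eigenvalues (`HasSchmidtRank.le_rank`).
-/

namespace ChannelDiscrimination

open Matrix

variable {a a' b : Type*} [Fintype a] [DecidableEq a] [Fintype a'] [DecidableEq a']
  [Fintype b] [DecidableEq b]

set_option linter.unusedSectionVars false

/-! ### Channels on positive semidefinite operators -/

open scoped Matrix.Norms.L2Operator in
theorem span_posSemidef :
    Submodule.span ℂ {X : Matrix a a ℂ | X.PosSemidef} = ⊤ := by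
  have h := CStarAlgebra.span_nonneg (A := Matrix a a ℂ)
  simpa only [Matrix.nonneg_iff_posSemidef] using h

theorem linearMap_eq_zero_of_isDensity (S : Matrix a a ℂ →ₗ[ℂ] Matrix b b ℂ)
    (h : ∀ σ, IsDensity σ → S σ = 0) : S = 0 := by
  refine LinearMap.ext_on span_posSemidef fun X (hX : X.PosSemidef) => ?_
  by_cases h0 : X.trace = 0
  · rw [hX.trace_eq_zero_iff.1 h0]
    simp
  · have hσ : IsDensity (X.trace⁻¹ • X) :=
      ⟨hX.smul (inv_nonneg.2 hX.trace_nonneg), by simp [h0]⟩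
    simpa [h0] using h _ hσ

open scoped Matrix.Norms.L2Operator in
theorem QuantumChannel.map_posSemidef (Φ : QuantumChannel a b) {X : Matrix a a ℂ}
    (hX : X.PosSemidef) : (Φ.map X).PosSemidef := by
  rw [← Matrix.nonneg_iff_posSemidef] at hX ⊢
  exact map_nonneg Φ.toCompletelyPositiveMap hX

theorem QuantumChannel.trace_map (Φ : QuantumChannel a b) (X : Matrix a a ℂ) :
    (Φ.map X).trace = X.trace :=
  Φ.trace_preserving X

theorem QuantumChannel.map_injective :
    Function.Injective (QuantumChannel.map : QuantumChannel a b → _) := by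
  rintro ⟨⟨f, _⟩, _⟩ ⟨⟨g, _⟩, _⟩ h
  obtain rfl : f = g := h
  rfl

/-- Positive maps preserve adjoints because the positive semidefinite matrices span. -/
theorem QuantumChannel.map_conjTranspose (Φ : QuantumChannel a b) (X : Matrix a a ℂ) :
    Φ.map Xᴴ = (Φ.map X)ᴴ := by
  have hX : X ∈ Submodule.span ℂ {X : Matrix a a ℂ | X.PosSemidef} := by
    rw [span_posSemidef]
    trivial
  induction hX using Submodule.span_induction with
  | mem Y hY => rw [hY.isHermitian.eq, (Φ.map_posSemidef hY).isHermitian.eq]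
  | zero => simp
  | add Y Z _ _ hY hZ => simp [hY, hZ]
  | smul c Y _ hY => simp [hY]

/-! ### The kernel of the M-operator -/

theorem choi_apply (S : Matrix a a ℂ →ₗ[ℂ] Matrix b b ℂ) (i j : b) (k l : a) :
    choi S (i, k) (j, l) = S (Matrix.single k l 1) i j := by
  simp only [choi, Matrix.sum_apply, Matrix.kroneckerMap_apply, Matrix.single_apply]
  rw [Finset.sum_eq_single k (by intro m _ hm; simp [hm]) (by simp),
    Finset.sum_eq_single l (by intro m _ hm; simp [hm]) (by simp)]
  simp

theorem traceFirst_eq_sum_submatrix (N : Matrix (b × a) (b × a) ℂ) :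
    traceFirst N = ∑ i, N.submatrix (Prod.mk i) (Prod.mk i) := by
  ext k l
  simp [traceFirst, Matrix.sum_apply]

theorem traceSecond_eq_sum_submatrix (N : Matrix (a × a') (a × a') ℂ) :
    traceSecond N = ∑ k, N.submatrix (fun i => (i, k)) (fun i => (i, k)) := by
  ext k l
  simp [traceSecond, Matrix.sum_apply]

theorem traceFirst_posSemidef {N : Matrix (b × a) (b × a) ℂ} (hN : N.PosSemidef) :
    (traceFirst N).PosSemidef := by
  rw [traceFirst_eq_sum_submatrix]
  exact Matrix.posSemidef_sum _ fun i _ => hN.submatrix _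

theorem traceSecond_posSemidef {N : Matrix (a × a') (a × a') ℂ} (hN : N.PosSemidef) :
    (traceSecond N).PosSemidef := by
  rw [traceSecond_eq_sum_submatrix]
  exact Matrix.posSemidef_sum _ fun i _ => hN.submatrix _

theorem trace_traceSecond (N : Matrix (a × a') (a × a') ℂ) :
    (traceSecond N).trace = N.trace := by
  simp [Matrix.trace, traceSecond, Fintype.sum_prod_type]

theorem posSemidef_abs (J : Matrix a a ℂ) : (CFC.abs J).PosSemidef :=
  Matrix.nonneg_iff_posSemidef.1 (CFC.abs_nonneg J)

theorem mOperator_posSemidef (S : Matrix a a ℂ →ₗ[ℂ] Matrix b b ℂ) :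
    (mOperator S).PosSemidef :=
  traceFirst_posSemidef (posSemidef_abs _)

theorem mulVec_eq_zero_of_abs_mulVec_eq_zero {J : Matrix a a ℂ} {w : a → ℂ}
    (h : CFC.abs J *ᵥ w = 0) : J *ᵥ w = 0 := by
  have h2 : Jᴴ *ᵥ (J *ᵥ w) = 0 := by
    rw [Matrix.mulVec_mulVec, ← Matrix.star_eq_conjTranspose, ← CFC.abs_mul_abs,
      ← Matrix.mulVec_mulVec, h, Matrix.mulVec_zero]
  rw [← dotProduct_star_self_eq_zero, Matrix.star_mulVec,
    ← Matrix.dotProduct_mulVec, h2, dotProduct_zero]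

/-- If a positive semidefinite `N` on `B ⊗ A` satisfies `Tr_B N v = 0`, then the nonnegative numbers
`⟨eᵢ ⊗ v, N (eᵢ ⊗ v)⟩` sum to zero, so `N` kills every `eᵢ ⊗ v`. -/
theorem mulVec_eq_zero_of_traceFirst_mulVec_eq_zero {N : Matrix (b × a) (b × a) ℂ}
    (hN : N.PosSemidef) {v : a → ℂ} (hv : traceFirst N *ᵥ v = 0) (i : b) :
    N *ᵥ (fun p => if p.1 = i then v p.2 else 0) = 0 := by
  have key : ∀ i, star (fun p : b × a => if p.1 = i then v p.2 else 0) ⬝ᵥ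
      N *ᵥ (fun p => if p.1 = i then v p.2 else 0) =
      star v ⬝ᵥ N.submatrix (Prod.mk i) (Prod.mk i) *ᵥ v := by
    intro i
    simp only [dotProduct, Matrix.mulVec, Fintype.sum_prod_type, Pi.star_apply, apply_ite star,
      star_zero, ite_mul, zero_mul, mul_ite, mul_zero, Matrix.submatrix_apply]
    rw [Finset.sum_comm]
    simp [Finset.sum_ite_irrel]
  have hsum : ∑ i, star v ⬝ᵥ N.submatrix (Prod.mk i) (Prod.mk i) *ᵥ v = 0 := by
    rw [← dotProduct_sum, ← Matrix.sum_mulVec, ← traceFirst_eq_sum_submatrix, hv,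
      dotProduct_zero]
  rw [Finset.sum_eq_zero_iff_of_nonneg
    fun i _ => (hN.submatrix (Prod.mk i)).dotProduct_mulVec_nonneg v] at hsum
  rw [← hN.dotProduct_mulVec_zero_iff, key]
  exact hsum i (Finset.mem_univ i)

/-- A vector `v` in the kernel of `M(S)` makes `S` vanish on all operators `|u⟩⟨v̄|`: the vectors
`eᵢ ⊗ v` lie in the kernel of `J(S)`, whose columns are the values of `S` on matrix units. -/
theorem map_vecMulVec_eq_zero_of_mOperator_mulVec_eq_zero
    (S : Matrix a a ℂ →ₗ[ℂ] Matrix b b ℂ) {v : a → ℂ} (hv : mOperator S *ᵥ v = 0)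
    (u : a → ℂ) : S (vecMulVec u v) = 0 := by
  have hunit : ∀ k, ∑ l, v l • S (Matrix.single k l 1) = 0 := by
    intro k
    ext j i
    have h := congrFun (mulVec_eq_zero_of_abs_mulVec_eq_zero
      (mulVec_eq_zero_of_traceFirst_mulVec_eq_zero (posSemidef_abs (choi S)) hv i)) (j, k)
    simp only [Matrix.mulVec, dotProduct, Fintype.sum_prod_type, choi_apply, mul_ite, mul_zero,
      Pi.zero_apply] at h
    rw [Finset.sum_comm] at h
    simpa [Matrix.sum_apply, mul_comm] using h
  have hdecomp : vecMulVec u v = ∑ k, u k • ∑ l, v l • Matrix.single k l (1 : ℂ) := by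
    ext i j
    simp [vecMulVec_apply, Matrix.sum_apply, Matrix.single_apply, Finset.sum_ite_irrel, ite_and]
  simp only [hdecomp, map_sum, map_smul, hunit, smul_zero, Finset.sum_const_zero]

/-! ### Compression to the complement of a vector -/

/-- The orthogonal projection onto the complement of the entrywise conjugate `v̄` of `v`
(the identity if `v = 0`). -/
noncomputable def complProj (v : a → ℂ) : Matrix a a ℂ :=
  1 - (star v ⬝ᵥ v)⁻¹ • vecMulVec (star v) v

theorem isHermitian_complProj (v : a → ℂ) : (complProj v).IsHermitian := by
  have h : star (star v ⬝ᵥ v) = star v ⬝ᵥ v := by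
    rw [← star_dotProduct_star, star_star, dotProduct_comm]
  simp [complProj, Matrix.IsHermitian, conjTranspose_vecMulVec, h]

theorem complProj_mul_self (v : a → ℂ) : complProj v * complProj v = complProj v := by
  by_cases hv : v = 0
  · simp [complProj, hv]
  have h : star v ⬝ᵥ v ≠ 0 := by simpa using hv
  simp only [complProj, sub_mul, mul_sub, one_mul, mul_one, smul_mul_assoc, mul_smul_comm,
    vecMulVec_mul_vecMulVec, dotProduct_comm v (star v),
    vecMulVec_smul, smul_smul, inv_mul_cancel₀ h, one_smul, sub_self, smul_zero,
    sub_zero]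

/-- For `v` in the kernel of `M(Δ)`, the map `Δ = Φ₁ - Φ₂` does not see a compression by
`complProj v`: it vanishes on every `X |v̄⟩⟨v̄|`, and on the adjoints of these since `Δ` preserves
adjoints. -/
theorem map_complProj_mul_mul (Φ₁ Φ₂ : QuantumChannel a b) {v : a → ℂ}
    (hv : mOperator (Φ₁.map - Φ₂.map) *ᵥ v = 0) (X : Matrix a a ℂ) :
    (Φ₁.map - Φ₂.map) (complProj v * X * complProj v) = (Φ₁.map - Φ₂.map) X := by
  have hstar : ∀ Y, (Φ₁.map - Φ₂.map) Yᴴ = ((Φ₁.map - Φ₂.map) Y)ᴴ := fun Y => by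
    simp [QuantumChannel.map_conjTranspose]
  have hright : ∀ Y, (Φ₁.map - Φ₂.map) (Y * complProj v) = (Φ₁.map - Φ₂.map) Y := fun Y => by
    rw [complProj, mul_sub, mul_one, mul_smul_comm, mul_vecMulVec, map_sub, map_smul,
      map_vecMulVec_eq_zero_of_mOperator_mulVec_eq_zero _ hv, smul_zero, sub_zero]
  rw [hright, ← conjTranspose_conjTranspose (complProj v * X), hstar, conjTranspose_mul,
    (isHermitian_complProj v).eq, hright, hstar, conjTranspose_conjTranspose]

theorem ampliate_kronecker_mul_mul (S : Matrix a a ℂ →ₗ[ℂ] Matrix b b ℂ) {P : Matrix a a ℂ}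
    (hP : ∀ Y, S (P * Y * P) = S Y) (X : Matrix (a × a') (a × a') ℂ) :
    ampliate S ((P ⊗ₖ (1 : Matrix a' a' ℂ)) * X * (P ⊗ₖ (1 : Matrix a' a' ℂ))) =
      ampliate S X := by
  ext p q
  simp only [ampliate, Matrix.of_apply]
  rw [← hP (Matrix.of fun i j => X (i, p.2) (j, q.2))]
  refine congrFun (congrFun (congrArg S ?_) p.1) q.1
  ext i j
  simp [Matrix.mul_apply, Fintype.sum_prod_type, Matrix.one_apply]

theorem traceSecond_kronecker_mul_mul (P : Matrix a a ℂ) (X : Matrix (a × a') (a × a') ℂ) :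
    traceSecond ((P ⊗ₖ (1 : Matrix a' a' ℂ)) * X * (P ⊗ₖ (1 : Matrix a' a' ℂ))) =
      P * traceSecond X * P := by
  rw [traceSecond_eq_sum_submatrix X, Matrix.mul_sum, Matrix.sum_mul]
  ext i j
  simp [traceSecond, Matrix.sum_apply, Matrix.mul_apply, Fintype.sum_prod_type, Matrix.one_apply]

theorem trace_compression (v : a → ℂ) (X : Matrix (a × a') (a × a') ℂ) :
    ((complProj v ⊗ₖ (1 : Matrix a' a' ℂ)) * X * (complProj v ⊗ₖ (1 : Matrix a' a' ℂ))).trace =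
      X.trace - (star v ⬝ᵥ v)⁻¹ * (star v ⬝ᵥ (traceSecond X)ᵀ *ᵥ v) := by
  rw [← trace_traceSecond, traceSecond_kronecker_mul_mul, Matrix.trace_mul_comm, ← mul_assoc,
    complProj_mul_self, complProj, sub_mul, one_mul, Matrix.trace_sub, trace_traceSecond,
    smul_mul_assoc, vecMulVec_mul, Matrix.trace_smul, trace_vecMulVec, mulVec_transpose,
    smul_eq_mul]

/-! ### The advantage over guessing -/

theorem trace_ampliate (Φ : QuantumChannel a b) (X : Matrix (a × a') (a × a') ℂ) :
    (ampliate Φ.map X).trace = X.trace := by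
  rw [← trace_traceSecond, ← trace_traceSecond, traceSecond_eq_sum_submatrix,
    traceSecond_eq_sum_submatrix, Matrix.trace_sum, Matrix.trace_sum]
  exact Finset.sum_congr rfl fun k _ =>
    Φ.trace_map (X.submatrix (fun i => (i, k)) fun i => (i, k))

theorem ampliate_smul (S : Matrix a a ℂ →ₗ[ℂ] Matrix b b ℂ) (c : ℂ)
    (X : Matrix (a × a') (a × a') ℂ) : ampliate S (c • X) = c • ampliate S X := by
  ext p q
  have h : (Matrix.of fun i j => (c • X) (i, p.2) (j, q.2)) =
      c • Matrix.of fun i j => X (i, p.2) (j, q.2) := rfl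
  rw [ampliate, Matrix.of_apply, h, map_smul]
  rfl

theorem ampliate_kronecker (S : Matrix a a ℂ →ₗ[ℂ] Matrix b b ℂ) (σ : Matrix a a ℂ)
    (ω : Matrix a' a' ℂ) : ampliate S (σ ⊗ₖ ω) = S σ ⊗ₖ ω := by
  ext p q
  have h : (Matrix.of fun i j => (σ ⊗ₖ ω) (i, p.2) (j, q.2)) = ω p.2 q.2 • σ := by
    ext i j
    simp [mul_comm]
  rw [ampliate, Matrix.of_apply, h, map_smul]
  simp [mul_comm]

/-- Since both channels preserve the trace, guessing succeeds with probability `1 / 2`, and the rest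
of the success probability is linear in `Φ₁ - Φ₂`. -/
theorem successProb_eq (Φ₁ Φ₂ : QuantumChannel a b) {ρ : Matrix (a × a') (a × a') ℂ}
    {E₁ E₂ : Matrix (b × a') (b × a') ℂ} (hρ : IsDensity ρ) (hE : IsMeasurement E₁ E₂) :
    successProb Φ₁ Φ₂ ρ E₁ E₂ =
      1 / 2 + 1 / 2 * (E₁ * ampliate (Φ₁.map - Φ₂.map) ρ).trace.re := by
  have hE₂ : E₂ = 1 - E₁ := eq_sub_of_add_eq' hE.2.2
  have hsub : ampliate (Φ₁.map - Φ₂.map) ρ = ampliate Φ₁.map ρ - ampliate Φ₂.map ρ := rfl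
  rw [successProb, hE₂, hsub, sub_mul, mul_sub, one_mul, Matrix.trace_sub, Matrix.trace_sub,
    trace_ampliate, hρ.2]
  simp only [Complex.sub_re, Complex.one_re]
  ring

open scoped Matrix.Norms.L2Operator in
/-- A nonzero traceless Hermitian operator is detected by the measurement with
`F₁ = (1 + H / ‖H‖) / 2`, for which `Tr (F₁ H) = Tr (H²) / (2 ‖H‖)`. -/
theorem exists_isMeasurement_trace_pos {H : Matrix a a ℂ} (hH : H.IsHermitian)
    (htr : H.trace = 0) (h0 : H ≠ 0) :
    ∃ F₁ F₂ : Matrix a a ℂ, IsMeasurement F₁ F₂ ∧ 0 < (F₁ * H).trace.re := by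
  have hn : 0 < ‖H‖ := norm_pos_iff.2 h0
  have hhalf : (0 : ℂ) ≤ 1 / (2 * (‖H‖ : ℂ)) := by
    have : (0 : ℝ) ≤ 1 / (2 * ‖H‖) := by positivity
    exact_mod_cast this
  have hne : (‖H‖ : ℂ) ≠ 0 := by exact_mod_cast hn.ne'
  have hup := (Matrix.le_iff.1 (IsSelfAdjoint.le_algebraMap_norm_self (a := H) hH)).smul hhalf
  have hlow := (Matrix.le_iff.1 (IsSelfAdjoint.neg_algebraMap_norm_le_self (a := H) hH)).smul hhalf
  have halg : algebraMap ℝ (Matrix a a ℂ) ‖H‖ = (‖H‖ : ℂ) • 1 := by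
    rw [Algebra.algebraMap_eq_smul_one, Complex.coe_smul]
  refine ⟨_, _, ⟨hlow, hup, ?_⟩, ?_⟩
  · rw [← smul_add, halg, sub_neg_eq_add, add_comm H, add_assoc, add_sub_cancel, ← two_smul ℂ,
      smul_smul, smul_smul]
    field_simp
    simp
  · have hpos : 0 < (H * H).trace := by
      have hps : (H * H).PosSemidef := by
        simpa [hH.eq] using Matrix.posSemidef_conjTranspose_mul_self H
      refine lt_of_le_of_ne hps.trace_nonneg fun h => h0 ?_
      have := Matrix.trace_conjTranspose_mul_self_eq_zero_iff (A := H)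
      rw [hH.eq] at this
      exact this.1 h.symm
    rw [halg, smul_mul_assoc, sub_neg_eq_add, add_mul, smul_mul_assoc, one_mul, Matrix.trace_smul,
      Matrix.trace_add, Matrix.trace_smul, htr, smul_zero, add_zero]
    have hpos' : (0 : ℂ) < (1 / (2 * (‖H‖ : ℂ))) • (H * H).trace :=
      mul_pos (lt_of_le_of_ne hhalf (by simp [h0])) hpos
    exact (Complex.lt_def.1 hpos').1

/-- At an optimal input the advantage `m` over guessing is positive, since the channels
differ, and by homogeneity `m * Tr X` bounds the advantage of any unnormalised input `X`. -/
theorem IsOptimalInput.exists_advantage {Φ₁ Φ₂ : QuantumChannel a b} (hne : Φ₁ ≠ Φ₂)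
    {ρ : Matrix (a × a') (a × a') ℂ} (h : IsOptimalInput Φ₁ Φ₂ ρ) :
    ∃ E : Matrix (b × a') (b × a') ℂ,
      0 < (E * ampliate (Φ₁.map - Φ₂.map) ρ).trace.re ∧
      ∀ X : Matrix (a × a') (a × a') ℂ, X.PosSemidef →
        (E * ampliate (Φ₁.map - Φ₂.map) X).trace.re ≤
          (E * ampliate (Φ₁.map - Φ₂.map) ρ).trace.re * X.trace.re := by
  obtain ⟨hρ, E₁, E₂, hE, hopt⟩ := h
  have hmax : ∀ (τ : Matrix (a × a') (a × a') ℂ) (F₁ F₂ : Matrix (b × a') (b × a') ℂ), IsDensity τ → IsMeasurement F₁ F₂ →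
      (F₁ * ampliate (Φ₁.map - Φ₂.map) τ).trace.re ≤
        (E₁ * ampliate (Φ₁.map - Φ₂.map) ρ).trace.re := fun τ F₁ F₂ hτ hF => by
    have := hopt τ F₁ F₂ hτ hF
    rw [successProb_eq Φ₁ Φ₂ hτ hF, successProb_eq Φ₁ Φ₂ hρ hE] at this
    linarith
  refine ⟨E₁, ?_, fun X hX => ?_⟩
  · by_contra! hle
    have hk : Nonempty a' := by
      by_contra hempty
      rw [not_nonempty_iff] at hempty
      simpa [Matrix.trace] using hρ.2
    obtain ⟨k⟩ := hk
    refine hne (QuantumChannel.map_injective (sub_eq_zero.1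
      (linearMap_eq_zero_of_isDensity _ fun σ hσ => ?_)))
    by_contra hΔ
    -- The product input `σ ⊗ |k⟩⟨k|` already separates the channels.
    have hω : (Matrix.single k k (1 : ℂ)).PosSemidef := by
      rw [← Matrix.diagonal_single, Matrix.posSemidef_diagonal_iff]
      intro i
      by_cases hi : i = k <;> simp [hi]
    have hτ : IsDensity (σ ⊗ₖ Matrix.single k k (1 : ℂ)) :=
      ⟨hσ.1.kronecker hω, by simp [Matrix.trace_kronecker, hσ.2]⟩
    obtain ⟨F₁, F₂, hF, hpos⟩ := exists_isMeasurement_trace_pos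
      (H := ampliate (Φ₁.map - Φ₂.map) (σ ⊗ₖ Matrix.single k k (1 : ℂ)))
      (by
        rw [ampliate_kronecker, Matrix.IsHermitian, conjTranspose_kronecker, hω.isHermitian.eq,
          LinearMap.sub_apply, conjTranspose_sub, ← Φ₁.map_conjTranspose, ← Φ₂.map_conjTranspose,
          hσ.1.isHermitian.eq])
      (by simp [ampliate_kronecker, Matrix.trace_kronecker, QuantumChannel.trace_map])
      (fun h0 => hΔ (by
        ext i j
        rw [ampliate_kronecker] at h0
        simpa using congrFun (congrFun h0 (i, k)) (j, k)))
    exact absurd (hmax _ F₁ F₂ hτ hF) (by linarith)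
  · by_cases h0 : X.trace = 0
    · rw [hX.trace_eq_zero_iff.1 h0, ← zero_smul ℂ (0 : Matrix (a × a') (a × a') ℂ), ampliate_smul]
      simp
    · have hτ : IsDensity (X.trace⁻¹ • X) :=
        ⟨hX.smul (inv_nonneg.2 hX.trace_nonneg), by simp [h0]⟩
      have hpos : 0 < X.trace := lt_of_le_of_ne hX.trace_nonneg (Ne.symm h0)
      have hreal : X.trace = (X.trace.re : ℂ) := Complex.eq_re_of_ofReal_le hX.trace_nonneg
      have hrpos : 0 < X.trace.re := (Complex.lt_def.1 hpos).1
      have := hmax _ E₁ E₂ hτ hE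
      rw [ampliate_smul, mul_smul_comm, Matrix.trace_smul, hreal, ← Complex.ofReal_inv,
        smul_eq_mul, Complex.re_ofReal_mul, inv_mul_le_iff₀ hrpos] at this
      linarith

/-! ### Supports and ranks -/

/-- For Hermitian matrices the supports are the orthogonal complements of the kernels. -/
theorem supp_le_supp_of_mulVec_eq_zero {M S : Matrix a a ℂ} (hM : M.IsHermitian)
    (hS : S.IsHermitian) (h : ∀ v, M *ᵥ v = 0 → S *ᵥ v = 0) : supp S ≤ supp M := by
  have hle := (ContinuousLinearMap.ker_le_ker_iff_range_le_range
    (T := S.toEuclideanLin.toContinuousLinearMap) (U := M.toEuclideanLin.toContinuousLinearMap)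
    (isSymmetric_toEuclideanLin_iff.2 hS) (isSymmetric_toEuclideanLin_iff.2 hM)).1
    fun x hx => WithLp.ofLp_injective 2 (h x.ofLp (congrArg WithLp.ofLp hx))
  rintro _ ⟨v, rfl⟩
  obtain ⟨w, hw⟩ := hle ⟨WithLp.toLp 2 v, rfl⟩
  exact ⟨w.ofLp, congrArg WithLp.ofLp hw⟩

theorem IsOptimalInput.isDensityOn {Φ₁ Φ₂ : QuantumChannel a b} (hne : Φ₁ ≠ Φ₂)
    {ρ : Matrix (a × a') (a × a') ℂ} (h : IsOptimalInput Φ₁ Φ₂ ρ) :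
    IsDensityOn (supp (mOperator (Φ₁.map - Φ₂.map))) (traceSecond ρ)ᵀ := by
  have hσ : (traceSecond ρ)ᵀ.PosSemidef := (traceSecond_posSemidef h.1.1).transpose
  refine ⟨⟨hσ, by rw [Matrix.trace_transpose, trace_traceSecond, h.1.2]⟩,
    supp_le_supp_of_mulVec_eq_zero (mOperator_posSemidef _).isHermitian hσ.isHermitian
      fun v hv => ?_⟩
  obtain ⟨E, hpos, hbound⟩ := h.exists_advantage hne
  have hQ : (complProj v ⊗ₖ (1 : Matrix a' a' ℂ))ᴴ = complProj v ⊗ₖ (1 : Matrix a' a' ℂ) := by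
    rw [conjTranspose_kronecker, (isHermitian_complProj v).eq, conjTranspose_one]
  have hX := h.1.1.mul_mul_conjTranspose_same (complProj v ⊗ₖ (1 : Matrix a' a' ℂ))
  rw [hQ] at hX
  -- The compression of `ρ` has the same, positive, advantage, so its trace
  -- `1 - ⟨v, (Tr_{A'} ρ)ᵀ v⟩ / ⟨v, v⟩` is at least `1`.
  have hle := hbound _ hX
  rw [ampliate_kronecker_mul_mul _ (map_complProj_mul_mul Φ₁ Φ₂ hv), trace_compression, h.1.2,
    Complex.sub_re, Complex.one_re] at hle
  have hq := mul_nonneg (inv_nonneg.2 (dotProduct_star_self_nonneg v))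
    (hσ.dotProduct_mulVec_nonneg v)
  have hzero : (star v ⬝ᵥ v)⁻¹ * (star v ⬝ᵥ (traceSecond ρ)ᵀ *ᵥ v) = 0 := by
    obtain ⟨hre, him⟩ := Complex.le_def.1 hq
    refine Complex.ext (le_antisymm ?_ hre) him.symm
    simp only [Complex.zero_re]
    nlinarith
  rcases mul_eq_zero.1 hzero with h0 | h0
  · rw [inv_eq_zero, dotProduct_star_self_eq_zero] at h0
    rw [h0, mulVec_zero]
  · exact (hσ.dotProduct_mulVec_zero_iff v).1 h0

/-- The left Schmidt vectors of `ψ` are eigenvectors of the reduced state, with the squared Schmidt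
coefficients as eigenvalues. -/
theorem traceSecond_pureState_mulVec {ψ : EuclideanSpace ℂ (a × a')} {r : ℕ} {c : Fin r → ℝ}
    {e : Fin r → EuclideanSpace ℂ a} {f : Fin r → EuclideanSpace ℂ a'} (he : Orthonormal ℂ e)
    (hf : Orthonormal ℂ f) (hψ : ∀ i k, ψ (i, k) = ∑ s, (c s : ℂ) * (e s i * f s k)) (s : Fin r) :
    traceSecond (pureState ψ) *ᵥ (e s).ofLp = ((c s : ℂ) ^ 2) • (e s).ofLp := by
  have hee : ∀ t, ∑ j, star (e t j) * e s j = if t = s then 1 else 0 := fun t => by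
    rw [← orthonormal_iff_ite.1 he t s, PiLp.inner_apply]
    simp [mul_comm]
  have hff : ∀ t u, ∑ k, f t k * star (f u k) = if u = t then 1 else 0 := fun t u => by
    rw [← orthonormal_iff_ite.1 hf u t, PiLp.inner_apply]
    simp
  have hσ : traceSecond (pureState ψ) =
      ∑ t, ((c t : ℂ) ^ 2) • vecMulVec (e t).ofLp (star (e t).ofLp) := by
    ext i j
    simp only [traceSecond, pureState, Matrix.of_apply, hψ, star_sum, Matrix.sum_apply,
      Finset.sum_mul_sum, Matrix.smul_apply, vecMulVec_apply, smul_eq_mul, Pi.star_apply]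
    rw [Finset.sum_comm]
    refine Finset.sum_congr rfl fun t _ => ?_
    rw [Finset.sum_comm]
    have : ∀ u, ∑ k, (c t : ℂ) * (e t i * f t k) * star ((c u : ℂ) * (e u j * f u k)) =
        c t * c u * (e t i * star (e u j)) * if u = t then 1 else 0 := fun u => by
      rw [← hff t u, Finset.mul_sum]
      refine Finset.sum_congr rfl fun k _ => ?_
      simp
      ring
    simp only [this, mul_ite, mul_one, mul_zero, Finset.sum_ite_eq', Finset.mem_univ, if_true]
    ring
  have hdot : ∀ t, star (e t).ofLp ⬝ᵥ (e s).ofLp = if t = s then 1 else 0 := hee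
  simp [hσ, Matrix.sum_mulVec, Matrix.smul_mulVec, vecMulVec_mulVec, hdot]

theorem HasSchmidtRank.le_rank {ψ : EuclideanSpace ℂ (a × a')} {r : ℕ}
    (h : HasSchmidtRank ψ r) : r ≤ (traceSecond (pureState ψ)).rank := by
  obtain ⟨c, e, f, hc, he, hf, hψ⟩ := h
  have hli : LinearIndependent ℂ fun s => (e s).ofLp :=
    he.linearIndependent.map' (WithLp.linearEquiv 2 ℂ (a → ℂ)).toLinearMap
      (LinearEquiv.ker _)
  have hmem : ∀ s, (e s).ofLp ∈ LinearMap.range (traceSecond (pureState ψ)).mulVecLin :=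
    fun s => ⟨((c s : ℂ) ^ 2)⁻¹ • (e s).ofLp, by
      have : (c s : ℂ) ≠ 0 := by exact_mod_cast (hc s).ne'
      rw [mulVecLin_apply, mulVec_smul, traceSecond_pureState_mulVec he hf hψ, smul_smul,
        inv_mul_cancel₀ (pow_ne_zero 2 this), one_smul]⟩
  have hspan := Submodule.finrank_mono (Submodule.span_le.2 (Set.range_subset_iff.2 hmem))
  rwa [finrank_span_eq_card hli, Fintype.card_fin] at hspan

end ChannelDiscrimination

theorem mainTheorem2 {a a' b : Type*} [Fintype a] [DecidableEq a] [Fintype a'] [DecidableEq a']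
    [Fintype b] [DecidableEq b] (Φ₁ Φ₂ : ChannelDiscrimination.QuantumChannel a b)
    (hne : Φ₁ ≠ Φ₂) :
    (∀ ρ : Matrix (a × a') (a × a') ℂ, ChannelDiscrimination.IsOptimalInput Φ₁ Φ₂ ρ →
      ChannelDiscrimination.IsDensityOn
        (ChannelDiscrimination.supp (ChannelDiscrimination.mOperator (Φ₁.map - Φ₂.map)))
        (ChannelDiscrimination.traceSecond ρ).transpose) ∧
    (∀ ρ : Matrix (a × a') (a × a') ℂ, ChannelDiscrimination.IsDensity ρ →
      (ChannelDiscrimination.mOperator (Φ₁.map - Φ₂.map)).rank <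
        (ChannelDiscrimination.traceSecond ρ).rank →
      ¬ ChannelDiscrimination.IsOptimalInput Φ₁ Φ₂ ρ) ∧
    (∀ (ψ : EuclideanSpace ℂ (a × a')) (r : ℕ), ‖ψ‖ = 1 →
      ChannelDiscrimination.HasSchmidtRank ψ r →
      (ChannelDiscrimination.mOperator (Φ₁.map - Φ₂.map)).rank < r →
      ¬ ChannelDiscrimination.IsOptimalInput Φ₁ Φ₂ (ChannelDiscrimination.pureState ψ)) := by
  have hrank : ∀ ρ : Matrix (a × a') (a × a') ℂ, ChannelDiscrimination.IsOptimalInput Φ₁ Φ₂ ρ →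
      (ChannelDiscrimination.traceSecond ρ).rank ≤
        (ChannelDiscrimination.mOperator (Φ₁.map - Φ₂.map)).rank := fun ρ h => by
    rw [← Matrix.rank_transpose]
    exact Submodule.finrank_mono (h.isDensityOn hne).2
  exact ⟨fun ρ h => h.isDensityOn hne, fun ρ _ hlt h => (hrank ρ h).not_gt hlt,
    fun ψ r _ hψ hlt h => (hψ.le_rank.trans (hrank _ h)).not_gt hlt⟩
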